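/- Consider a school choice problem with a finite set $\mathcal I$ of students, a finite set $\mathcal S$ of schools and a finite set $\mathcal M$ of student types. Student $i$ has type $\tau(i)\in\mathcal M$ and a strict preference relation $P_i$ (a strict total order) over $\mathcal S\cup\{\emptyset\}$, where $\emptyset$ stands for being unmatched and $s$ is acceptable to $i$ if $s\,P_i\,\emptyset$; $R_i$ is the associated weak preference. School $s$ has capacity $q_s$, a reserve quota $q_s^m$ for each type $m$, with $\sum_m q^m_s<q_s$ and $q^m_s<|\{i:\tau(i)=m\}|$, the open quota $q^o_s=q_s-\sum_m q_s^m$, and a strict priority order over students, given by pairwise distinct priority scores. Each school $s$ is divided into an open subschool $s^o$ and a reserved subschool $s^r$. A strategy of a student is a preference list of subschools: a list without repetitions, best first, where unlisted subschools are reported as unacceptable. SimSep and SimFlex are the student-proposing deferred acceptance mechanisms over these lists: in each round each unassigned student applies to the first subschool on her list that has not rejected her, and each school $s$ selects tentatively from the set $I$ of students applying to or held by $s^o$ and the set $I'$ of students applying to or held by $s^r$, rejecting the others, until there are no more rejections. In both mechanisms, for each type $m$, $s^r$ selects the highest-ranked type-$m$ students of $I'$ up to the quota $q_s^m$. In SimSep,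 $s^o$ selects the highest-ranked students of $I$ up to the quota $q^o_s$; in SimFlex, it selects the highest-ranked students of $I$ up to the number of seats, out of $q_s$, that are left after the reserved selection. A list is consistent with $P_i$ if it contains both subschools of every acceptable school and no subschool of an unacceptable school, ranks $s^o$ and $s^r$ adjacently (in either order) for every acceptable $s$, and orders schools as $P_i$ does. A strategy of $i$ is weakly dominant if, whatever lists the other students submit, it gives $i$ a school (or $\emptyset$) that is at least as good under $P_i$ as the one she gets from any other list. A matching assigns to each student a school and a seat type (open or reserved), or leaves her unmatched, such that each school $s$ admits at most $q_s$ students and at most $q_s^m$ type-$m$ students in reserved seats. A matching $\mu$ is stable if $\mu(i)\,R_i\,\emptyset$ for all $i$; whenever $s\,P_i\,\mu(i)$, school $s$ admits exactly $q_s$ students and has exactly $q_s^{\tau(i)}$ students of type $\tau(i)$ in reserved seats; and there are no students $i,j$ such that $j$ is admitted to a school $s$ with $s\,P_i\,\mu(i)$, $i$ has higher priority than $j$ at $s$, and either $\tau(i)=\tau(j)$ or $j$ occupies an open seat. **Proposition.** In SimSep and in SimFlex, it is a weakly dominant strategy for every student to submit any preference list of subschools that is consistent with her true preferences. When all students submit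 lists consistent with their true preferences, and more generally when all students play weakly dominant strategies, the result of SimFlex is a stable matching. -/

import Mathlib

namespace SchoolChoice

/-- The two types of seats. -/
inductive Seat
  | opn
  | res
  deriving DecidableEq

instance : Fintype Seat where
  elems := {Seat.opn, Seat.res}
  complete := fun t => by cases t <;> decide

/-- A school choice problem with reserve quotas, without the preferences of the students.
`I` is the set of students, `S` the set of schools, `M` the set of student types. -/
structure Problem (I S M : Type*) [Fintype I] [Fintype M] [DecidableEq M] where
  /-- capacities `q_s` -/
  q : S → ℕ
  /-- reserve quotas `q^m_s` -/
  qr : S → M → ℕ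
  /-- types of the students -/
  τ : I → M
  /-- priority scores `π_{i,s}`; student `i` has higher priority than `j` at `s`
  iff `π j s < π i s` -/
  π : I → S → ℕ
  /-- the priorities of each school are strict -/
  π_inj : ∀ s, Function.Injective fun i => π i s
  /-- every school has an open seat -/
  sum_qr_lt : ∀ s, ∑ m, qr s m < q s
  /-- reserve quotas are smaller than the number of students of the type -/
  qr_lt_card : ∀ s m, qr s m < (Finset.univ.filter fun i => τ i = m).card

/-- The subschools `s^o = (s, opn)` and `s^r = (s, res)`. -/
abbrev Subschool (S : Type*) := S × Seat

/-- A preference list of subschools: a finite list without repetitions, best first.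
A subschool that is not listed is reported as unacceptable. -/
abbrev PrefList (S : Type*) := {L : List (Subschool S) // L.Nodup}

/-- A matching: the subschool (school and seat type) of each student, `none` if unmatched. -/
abbrev Matching (I S : Type*) := I → Option (Subschool S)

/-- A school's choice rule: from the disjoint sets of applicants to its open and to its reserved
subschool, it selects the students who get a seat of each type. -/
abbrev ChoiceRule (I : Type*) := Finset I → Finset I → Seat → Finset I

/-- A mechanism in which students submit preference lists of subschools. -/
abbrev Mechanism (I S : Type*) := (I → PrefList S) → Matching I S

section Matchings

variable {I S : Type*}

/-- The school (or the null school) of student `i`. -/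
def Matching.school (μ : Matching I S) (i : I) : Option S := (μ i).map Prod.fst

variable [Fintype I] [DecidableEq S]

/-- The students admitted to `s`. -/
def Matching.admitted (μ : Matching I S) (s : S) : Finset I :=
  Finset.univ.filter fun i => μ.school i = some s

/-- The type-`m` students who occupy reserved seats of `s`. -/
def Matching.reservedOf {M : Type*} [DecidableEq M] (μ : Matching I S) (τ : I → M) (s : S) (m : M) :
    Finset I :=
  Finset.univ.filter fun i => μ i = some (s, Seat.res) ∧ τ i = m

end Matchings

/-- The weak preference `R` of a strict preference `P`. -/
def WeakPref {α : Type*} (P : α → α → Prop) (a b : α) : Prop := P a b ∨ a = b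

/-- The list `L` is consistent with the preference `P` over schools and the null school `none`:
it contains exactly the subschools of the acceptable schools, with the two subschools of a school
ranked adjacently (in either order), and with the schools in the same order as in `P`. -/
structure PrefList.ConsistentWith {S : Type*} (L : PrefList S) (P : Option S → Option S → Prop) :
    Prop where
  mem_iff : ∀ s t, (s, t) ∈ L.1 ↔ P (some s) none
  adjacent : ∀ s, P (some s) none →
    [(s, Seat.opn), (s, Seat.res)] <:+: L.1 ∨ [(s, Seat.res), (s, Seat.opn)] <:+: L.1
  order : L.1.Pairwise fun x y => x.1 ≠ y.1 → P (some x.1) (some y.1)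

/-- In the mechanism `ψ`, submitting `L` is weakly dominant for student `i` with preference `P`:
whatever the others submit, no list gives her a school that she prefers. -/
def IsWeaklyDominant {I S : Type*} [DecidableEq I] (ψ : Mechanism I S)
    (P : Option S → Option S → Prop) (i : I) (L : PrefList S) : Prop :=
  ∀ (σ : I → PrefList S) (L' : PrefList S),
    WeakPref P (Matching.school (ψ (Function.update σ i L)) i)
      (Matching.school (ψ (Function.update σ i L')) i)

section DA

variable {I S : Type*} [Fintype I] [DecidableEq I] [Fintype S] [DecidableEq S]

/-- The subschool to which student `i` applies (or which tentatively holds her):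
the best one on her list that has not rejected her. `R` is the set of all rejections so far. -/
def offer (σ : I → PrefList S) (R : Finset (I × Subschool S)) (i : I) : Option (Subschool S) :=
  (σ i).1.find? fun x => decide ((i, x) ∉ R)

/-- The students applying to, or tentatively held by, a subschool. -/
def applicants (σ : I → PrefList S) (R : Finset (I × Subschool S)) (x : Subschool S) : Finset I :=
  Finset.univ.filter fun i => offer σ R i = some x

/-- One round of deferred acceptance: every school applies its choice rule to the students who are
applying to it or tentatively held by it; those not chosen for the seat are rejected. -/
def daRound (C : S → ChoiceRule I) (σ : I → PrefList S) (R : Finset (I × Subschool S)) :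
    Finset (I × Subschool S) :=
  R ∪ Finset.univ.filter fun p =>
    p.1 ∈ applicants σ R p.2 ∧
      p.1 ∉ C p.2.1 (applicants σ R (p.2.1, Seat.opn)) (applicants σ R (p.2.1, Seat.res)) p.2.2

/-- All rejections made by deferred acceptance. Each round before the algorithm stops makes a new
rejection, so that `|I × Subschool S|` rounds are enough; see `daRound_daRejections`. -/
def daRejections (C : S → ChoiceRule I) (σ : I → PrefList S) : Finset (I × Subschool S) :=
  (daRound C σ)^[Fintype.card (I × Subschool S)] ∅

/-- The algorithm has stopped: a further round changes nothing. -/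
theorem daRound_daRejections (C : S → ChoiceRule I) (σ : I → PrefList S) :
    daRound C σ (daRejections C σ) = daRejections C σ := by
  by_contra hne
  have key : ∀ k, k ≤ Fintype.card (I × Subschool S) + 1 → k ≤ ((daRound C σ)^[k] ∅).card := by
    intro k
    induction k with
    | zero => intro _; exact Nat.zero_le _
    | succ k ih =>
      intro hk
      have h1 := ih (by omega)
      have hsub : (daRound C σ)^[k] ∅ ⊆ (daRound C σ)^[k + 1] ∅ := by
        rw [Function.iterate_succ_apply']
        exact Finset.subset_union_left
      have hneq : (daRound C σ)^[k] ∅ ≠ (daRound C σ)^[k + 1] ∅ := by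
        intro h
        rw [Function.iterate_succ_apply'] at h
        apply hne
        obtain ⟨d, hd⟩ := Nat.exists_eq_add_of_le (show k ≤ Fintype.card (I × Subschool S) by omega)
        have hfix : (daRound C σ)^[Fintype.card (I × Subschool S)] ∅ = (daRound C σ)^[k] ∅ := by
          rw [hd, Nat.add_comm, Function.iterate_add_apply]
          exact Function.iterate_fixed h.symm d
        rw [daRejections, hfix]
        exact h.symm
      have := Finset.card_lt_card (Finset.ssubset_iff_subset_ne.2 ⟨hsub, hneq⟩)
      omega
  have h := key _ le_rfl
  have := Finset.card_le_univ ((daRound C σ)^[Fintype.card (I × Subschool S) + 1] ∅)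
  omega

/-- The student-proposing deferred acceptance mechanism with choice rules `C`. -/
def deferredAcceptance (C : S → ChoiceRule I) : Mechanism I S :=
  fun σ => offer σ (daRejections C σ)

end DA

namespace Problem

variable {I S M : Type*} [Fintype I] [DecidableEq I] [Fintype S] [DecidableEq S]
  [Fintype M] [DecidableEq M]

/-- The `n` highest-ranked students of `A` at `s` (all of `A` if there are fewer). -/
def top (E : Problem I S M) (s : S) (n : ℕ) (A : Finset I) : Finset I :=
  A.filter fun i => (A.filter fun j => E.π i s < E.π j s).card < n

/-- The applicants in `A` who get reserved seats of `s`: for each type `m`,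
the highest-ranked ones of type `m` up to the quota. -/
def chooseReserved (E : Problem I S M) (s : S) (A : Finset I) : Finset I :=
  Finset.univ.biUnion fun m => E.top s (E.qr s m) (A.filter fun i => E.τ i = m)

/-- The choice rule of SimSep: open seats and reserved seats are allocated separately. -/
def choiceSep (E : Problem I S M) (s : S) : ChoiceRule I
  | A, _, Seat.opn => E.top s (E.q s - ∑ m, E.qr s m) A
  | _, A', Seat.res => E.chooseReserved s A'

/-- The choice rule of SimFlex: after reserved seats have been allocated, all remaining seats are
allocated as open seats. -/
def choiceFlex (E : Problem I S M) (s : S) : ChoiceRule I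
  | A, A', Seat.opn => E.top s (E.q s - (E.chooseReserved s A').card) A
  | _, A', Seat.res => E.chooseReserved s A'

/-- The mechanism SimSep. -/
def simSep (E : Problem I S M) : Mechanism I S := deferredAcceptance E.choiceSep

/-- The mechanism SimFlex. -/
def simFlex (E : Problem I S M) : Mechanism I S := deferredAcceptance E.choiceFlex

/-- Capacities and reserve quotas are respected. -/
def IsFeasible (E : Problem I S M) (μ : Matching I S) : Prop :=
  (∀ s, (μ.admitted s).card ≤ E.q s) ∧ ∀ s m, (μ.reservedOf E.τ s m).card ≤ E.qr s m

/-- Student `i` has justified envy towards `j`. -/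
def JustifiedEnvy (E : Problem I S M) (P : I → Option S → Option S → Prop) (μ : Matching I S)
    (i j : I) : Prop :=
  ∃ s, μ.school j = some s ∧ P i (some s) (μ.school i) ∧ E.π j s < E.π i s ∧
    (E.τ i = E.τ j ∨ μ j = some (s, Seat.opn))

/-- `μ` is a stable matching under the preferences `P`. -/
structure IsStable (E : Problem I S M) (P : I → Option S → Option S → Prop) (μ : Matching I S) :
    Prop where
  feasible : E.IsFeasible μ
  individuallyRational : ∀ i, WeakPref (P i) (μ.school i) none
  nonWasteful : ∀ i s, P i (some s) (μ.school i) → (μ.admitted s).card = E.q s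
  reserveNonWasteful : ∀ i s, P i (some s) (μ.school i) →
    (μ.reservedOf E.τ s (E.τ i)).card = E.qr s (E.τ i)
  noJustifiedEnvy : ∀ i j, ¬ E.JustifiedEnvy P μ i j

end Problem

end SchoolChoice

set_option linter.unusedSectionVars false

namespace SchoolChoice

/-! Treat a pair (student, subschool) as a contract. Both choice rules are substitutable, and the
total number of students a school selects never falls when its applicant pools grow (law of
aggregate demand, counted over both seat types together). Everything about incentives follows from
these two properties. The central object is a fixed set of rejections (`IsFixed`): one that equals
what the schools reject out of all offers which it triggers. Deferred acceptance produces the least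
one, and all fixed sets for the same lists leave the same students unmatched and the same number of
students at each school (the rural hospitals theorem).

Fixed sets survive the removal of rejected contracts from the lists (`IsFixed.restrict`). Hence a
student who obtains `x` by some list is matched when she lists only `x`. By the same argument she is
then matched by the initial segment up to `x` of any list containing `x`, and later entries do not
matter: she gets `x` or an entry listed before it. For a consistent list this is weak dominance.

For stability, let everybody play a weakly dominant strategy and let `i` prefer `s` to her
assignment. If the others list only their assignments, `i` still gets the same school by her own
list, so by dominance listing one subschool of `s` alone cannot get her into it. Thus neither seat
type of `s` would select her if she joined its present holders. Read off from the SimFlex choice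
rule, this says that the quotas are filled with students of no lower priority. -/

/-- A choice rule that selects among the applicants, is substitutable (who is selected remains so
when competitors leave), and satisfies the law of aggregate demand. -/
structure ChoiceRule.IsRegular {I : Type*} (c : ChoiceRule I) : Prop where
  subset_opn : ∀ A A', c A A' Seat.opn ⊆ A
  subset_res : ∀ A A', c A A' Seat.res ⊆ A'
  subst_opn : ∀ {A A' B B'} {i : I}, A ⊆ B → A' ⊆ B' → i ∈ A → i ∈ c B B' Seat.opn →
    i ∈ c A A' Seat.opn
  subst_res : ∀ {A A' B B'} {i : I}, A ⊆ B → A' ⊆ B' → i ∈ A' → i ∈ c B B' Seat.res →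
    i ∈ c A A' Seat.res
  card_le : ∀ {A A' B B'}, A ⊆ B → A' ⊆ B' →
    (c A A' Seat.opn).card + (c A A' Seat.res).card ≤
      (c B B' Seat.opn).card + (c B B' Seat.res).card

/-! ### Choice from sets of contracts -/

section Contracts

variable {I S : Type*} [Fintype I] [DecidableEq I] [DecidableEq S]

/-- The students with a contract in `Y` for the subschool `x`. -/
def proposers (Y : Finset (I × Subschool S)) (x : Subschool S) : Finset I :=
  Finset.univ.filter fun i => (i, x) ∈ Y

/-- The contracts selected from `Y` when every school applies its choice rule. -/
def jointChoice (C : S → ChoiceRule I) (Y : Finset (I × Subschool S)) :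
    Finset (I × Subschool S) :=
  Y.filter fun p =>
    p.1 ∈ C p.2.1 (proposers Y (p.2.1, Seat.opn)) (proposers Y (p.2.1, Seat.res)) p.2.2

/-- The contracts in `Y` with school `s`. -/
def atSchool (Y : Finset (I × Subschool S)) (s : S) : Finset (I × Subschool S) :=
  Y.filter fun p => p.2.1 = s

variable {C : S → ChoiceRule I} {Y Z : Finset (I × Subschool S)}

theorem mem_proposers {i : I} {x : Subschool S} : i ∈ proposers Y x ↔ (i, x) ∈ Y := by
  simp [proposers]

theorem proposers_mono (h : Y ⊆ Z) (x : Subschool S) : proposers Y x ⊆ proposers Z x := by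
  intro i hi
  rw [mem_proposers] at *
  exact h hi

theorem jointChoice_subset : jointChoice C Y ⊆ Y := Finset.filter_subset _ _

theorem mem_jointChoice (hC : ∀ s, (C s).IsRegular) {i : I} {s : S} {t : Seat} :
    (i, (s, t)) ∈ jointChoice C Y ↔
      i ∈ C s (proposers Y (s, Seat.opn)) (proposers Y (s, Seat.res)) t := by
  rw [jointChoice, Finset.mem_filter, and_iff_right_iff_imp]
  intro h
  rw [← mem_proposers]
  cases t
  · exact (hC s).subset_opn _ _ h
  · exact (hC s).subset_res _ _ h

theorem jointChoice_subst (hC : ∀ s, (C s).IsRegular) (h : Y ⊆ Z) {p : I × Subschool S}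
    (hp : p ∈ Y) (hpZ : p ∈ jointChoice C Z) : p ∈ jointChoice C Y := by
  obtain ⟨i, s, t⟩ := p
  rw [mem_jointChoice hC] at *
  cases t
  · exact (hC s).subst_opn (proposers_mono h _) (proposers_mono h _) (mem_proposers.2 hp) hpZ
  · exact (hC s).subst_res (proposers_mono h _) (proposers_mono h _) (mem_proposers.2 hp) hpZ

theorem card_atSchool (Y : Finset (I × Subschool S)) (s : S) :
    (atSchool Y s).card =
      (proposers Y (s, Seat.opn)).card + (proposers Y (s, Seat.res)).card := by
  have h : atSchool Y s = (proposers Y (s, Seat.opn)).image (fun i => (i, (s, Seat.opn))) ∪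
      (proposers Y (s, Seat.res)).image (fun i => (i, (s, Seat.res))) := by
    ext ⟨i, s', t⟩
    cases t <;> simp only [atSchool, Finset.mem_filter, Finset.mem_union, Finset.mem_image,
      mem_proposers, Prod.mk.injEq] <;> grind
  rw [h, Finset.card_union_of_disjoint, Finset.card_image_of_injective,
    Finset.card_image_of_injective]
  · intro a b hab; simpa using hab
  · intro a b hab; simpa using hab
  · rw [Finset.disjoint_left]
    intro p hp hp'
    simp only [Finset.mem_image] at hp hp'
    grind

theorem proposers_jointChoice (hC : ∀ s, (C s).IsRegular) (Y : Finset (I × Subschool S))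
    (s : S) (t : Seat) : proposers (jointChoice C Y) (s, t) =
      C s (proposers Y (s, Seat.opn)) (proposers Y (s, Seat.res)) t := by
  ext i
  rw [mem_proposers, mem_jointChoice hC]

theorem card_atSchool_jointChoice_le (hC : ∀ s, (C s).IsRegular) (h : Y ⊆ Z) (s : S) :
    (atSchool (jointChoice C Y) s).card ≤ (atSchool (jointChoice C Z) s).card := by
  simp only [card_atSchool, proposers_jointChoice hC]
  exact (hC s).card_le (proposers_mono h _) (proposers_mono h _)

variable [Fintype S]

theorem card_eq_sum_atSchool (Y : Finset (I × Subschool S)) :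
    Y.card = ∑ s, (atSchool Y s).card :=
  Finset.card_eq_sum_card_fiberwise fun _ _ => Finset.mem_coe.2 (Finset.mem_univ _)

/-- Irrelevance of rejected contracts. -/
theorem jointChoice_eq_of_subset (hC : ∀ s, (C s).IsRegular) (h : Y ⊆ Z)
    (hZ : jointChoice C Z ⊆ Y) : jointChoice C Y = jointChoice C Z := by
  symm
  -- Substitutability gives one inclusion; the law of aggregate demand, summed over schools, bounds
  -- the cardinality the other way.
  apply Finset.eq_of_subset_of_card_le
  · exact fun p hp => jointChoice_subst hC h (hZ hp) hp
  · rw [card_eq_sum_atSchool, card_eq_sum_atSchool (jointChoice C Z)]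
    exact Finset.sum_le_sum fun s _ => card_atSchool_jointChoice_le hC h s

/-! ### Deferred acceptance as the least fixed set of rejections -/

/-- Going down the list `l`, student `i` reaches `x` if all better subschools have rejected her. -/
def Reaches (l : List (Subschool S)) (R : Finset (I × Subschool S)) (i : I)
    (x : Subschool S) : Prop :=
  ∃ as bs, l = as ++ x :: bs ∧ ∀ a ∈ as, (i, a) ∈ R

open Classical in
/-- All contracts that have been offered when `R` is the set of rejections. -/
noncomputable def offers (σ : I → PrefList S) (R : Finset (I × Subschool S)) :
    Finset (I × Subschool S) :=
  Finset.univ.filter fun p => Reaches (σ p.1).1 R p.1 p.2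

/-- The contracts that are currently offered or held. -/
def held (σ : I → PrefList S) (R : Finset (I × Subschool S)) : Finset (I × Subschool S) :=
  Finset.univ.filter fun p => offer σ R p.1 = some p.2

variable {σ σ' : I → PrefList S} {R R' : Finset (I × Subschool S)}

theorem mem_offers {i : I} {x : Subschool S} :
    (i, x) ∈ offers σ R ↔ Reaches (σ i).1 R i x := by
  simp [offers]

theorem mem_held {i : I} {x : Subschool S} : (i, x) ∈ held σ R ↔ offer σ R i = some x := by
  simp [held]

theorem offer_eq_some_iff {i : I} {x : Subschool S} :
    offer σ R i = some x ↔ Reaches (σ i).1 R i x ∧ (i, x) ∉ R := by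
  rw [offer, List.find?_eq_some_iff_append]
  simp only [decide_eq_true_eq, Reaches, Bool.not_eq_true', decide_eq_false_iff_not, not_not]
  tauto

theorem offer_eq_none_iff {i : I} :
    offer σ R i = none ↔ ∀ x ∈ (σ i).1, (i, x) ∈ R := by
  simp [offer, List.find?_eq_none]

theorem Reaches.mem {l : List (Subschool S)} {i : I} {x : Subschool S} (h : Reaches l R i x) :
    x ∈ l := by
  obtain ⟨as, bs, rfl, -⟩ := h
  simp

theorem Reaches.mono {l : List (Subschool S)} {i : I} {x : Subschool S} (h : Reaches l R i x)
    (hR : ∀ y, (i, y) ∈ R → (i, y) ∈ R') : Reaches l R' i x := by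
  obtain ⟨as, bs, hl, h⟩ := h
  exact ⟨as, bs, hl, fun a ha => hR a (h a ha)⟩

theorem reaches_singleton {i : I} {x y : Subschool S} : Reaches [y] R i x ↔ x = y := by
  constructor
  · intro h; simpa using h.mem
  · rintro rfl
    exact ⟨[], [], rfl, by simp⟩

theorem offers_mono (h : R ⊆ R') : offers σ R ⊆ offers σ R' := by
  rintro ⟨i, x⟩ hp
  rw [mem_offers] at *
  exact hp.mono fun y hy => h hy

theorem mem_held_iff {p : I × Subschool S} : p ∈ held σ R ↔ p ∈ offers σ R ∧ p ∉ R := by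
  obtain ⟨i, x⟩ := p
  rw [mem_held, mem_offers, offer_eq_some_iff]

theorem held_subset_offers : held σ R ⊆ offers σ R := fun _ hp => (mem_held_iff.1 hp).1

/-- `R` is exactly the set of contracts rejected from those that are offered when `R` is the set of
rejections. -/
def IsFixed (C : S → ChoiceRule I) (σ : I → PrefList S) (R : Finset (I × Subschool S)) : Prop :=
  ∀ p, p ∈ R ↔ p ∈ offers σ R ∧ p ∉ jointChoice C (offers σ R)

theorem IsFixed.jointChoice_offers (h : IsFixed C σ R) :
    jointChoice C (offers σ R) = held σ R := by
  ext p
  rw [mem_held_iff, h p]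
  have : p ∈ jointChoice C (offers σ R) → p ∈ offers σ R := fun hp => jointChoice_subset hp
  tauto

theorem proposers_held (x : Subschool S) : proposers (held σ R) x = applicants σ R x := by
  ext i
  simp [mem_proposers, mem_held, applicants]

theorem mem_daRound {p : I × Subschool S} :
    p ∈ daRound C σ R ↔ p ∈ R ∨ (p ∈ held σ R ∧ p ∉ jointChoice C (held σ R)) := by
  obtain ⟨i, s, t⟩ := p
  simp only [daRound, Finset.mem_union, Finset.mem_filter, Finset.mem_univ, true_and,
    jointChoice, proposers_held]
  rw [← proposers_held, mem_proposers]
  tauto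

theorem daRejections_induction {motive : Finset (I × Subschool S) → Prop} (h0 : motive ∅)
    (hs : ∀ R, motive R → motive (daRound C σ R)) : motive (daRejections C σ) := by
  rw [daRejections]
  generalize Fintype.card (I × Subschool S) = n
  induction n with
  | zero => exact h0
  | succ n ih =>
    rw [Function.iterate_succ_apply']
    exact hs _ ih

/-- As long as the rejections so far lie in `R`, the contracts held in a round are among the offers
triggered by `R`, so by substitutability whatever the round rejects is also rejected from that
larger pool. -/
theorem daRejections_subset (hC : ∀ s, (C s).IsRegular) (h : IsFixed C σ R) :
    daRejections C σ ⊆ R := by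
  refine daRejections_induction (motive := fun Q => Q ⊆ R) (Finset.empty_subset _) ?_
  intro Q hQ p hp
  rcases mem_daRound.1 hp with hp | ⟨hp, hp'⟩
  · exact hQ hp
  · have hsub : held σ Q ⊆ offers σ R := held_subset_offers.trans (offers_mono hQ)
    exact (h p).2 ⟨hsub hp, fun hc => hp' (jointChoice_subst hC hsub hp hc)⟩

/-- The algorithm chooses from the contracts currently held, whereas fixedness concerns all offers
ever made. Rejected contracts stay rejected as the pool of offers grows, which is an invariant of
the rounds. At termination, irrelevance of rejected contracts identifies the two choices, so an
unselected offer not yet rejected would be rejected in a further round. -/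
theorem isFixed_daRejections (hC : ∀ s, (C s).IsRegular) (σ : I → PrefList S) :
    IsFixed C σ (daRejections C σ) := by
  have h1 : ∀ p ∈ daRejections C σ, p ∈ offers σ (daRejections C σ) ∧
      p ∉ jointChoice C (offers σ (daRejections C σ)) := by
    refine daRejections_induction (motive := fun Q => ∀ p ∈ Q, p ∈ offers σ Q ∧
      p ∉ jointChoice C (offers σ Q)) (by simp) ?_
    intro Q hQ p hp
    have hsub : offers σ Q ⊆ offers σ (daRound C σ Q) := offers_mono Finset.subset_union_left
    rcases mem_daRound.1 hp with hp | ⟨hp, hp'⟩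
    · obtain ⟨ha, hb⟩ := hQ p hp
      exact ⟨hsub ha, fun hc => hb (jointChoice_subst hC hsub ha hc)⟩
    · have hsub' := held_subset_offers.trans hsub
      exact ⟨hsub' hp, fun hc => hp' (jointChoice_subst hC hsub' hp hc)⟩
  have h2 := daRound_daRejections C σ
  generalize daRejections C σ = R at h1 h2
  have h3 : jointChoice C (held σ R) = jointChoice C (offers σ R) := by
    refine jointChoice_eq_of_subset hC held_subset_offers fun p hp => ?_
    exact mem_held_iff.2 ⟨jointChoice_subset hp, fun hR => (h1 p hR).2 hp⟩
  refine fun p => ⟨h1 p, fun hp => ?_⟩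
  by_contra hR
  apply hR
  rw [← h2]
  exact mem_daRound.2 (Or.inr ⟨mem_held_iff.2 ⟨hp.1, hR⟩, by rw [h3]; exact hp.2⟩)

/-- Dropping rejected contracts leaves a fixed set of rejections. -/
theorem IsFixed.restrict (hC : ∀ s, (C s).IsRegular) (h : IsFixed C σ R)
    (hsub : offers σ' R' ⊆ offers σ R) (hheld : held σ R ⊆ offers σ' R')
    (hR : ∀ p, p ∈ R' ↔ p ∈ R ∧ p ∈ offers σ' R') : IsFixed C σ' R' := by
  intro p
  -- The new pool lies between the old choice and the old pool, so the choice does not change.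
  rw [jointChoice_eq_of_subset hC hsub (by rwa [h.jointChoice_offers]), hR, h p]
  constructor
  · tauto
  · exact fun hp => ⟨⟨hsub hp.1, hp.2⟩, hp.1⟩

/-! ### The rural hospitals theorem -/

/-- The students who are applying somewhere. -/
def matched (σ : I → PrefList S) (R : Finset (I × Subschool S)) : Finset I :=
  Finset.univ.filter fun i => offer σ R i ≠ none

theorem card_held (σ : I → PrefList S) (R : Finset (I × Subschool S)) :
    (held σ R).card = (matched σ R).card := by
  refine Finset.card_bij (fun p _ => p.1) ?_ ?_ ?_
  · rintro ⟨i, x⟩ hp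
    simp [matched, mem_held.1 hp]
  · rintro ⟨i, x⟩ hp ⟨j, y⟩ hp' (rfl : i = j)
    rw [mem_held] at hp hp'
    simpa [hp] using hp'
  · intro i hi
    obtain ⟨x, hx⟩ := Option.ne_none_iff_exists'.1 (Finset.mem_filter.1 hi).2
    exact ⟨(i, x), mem_held.2 hx, rfl⟩

theorem matched_anti (h : R ⊆ R') : matched σ R' ⊆ matched σ R := by
  intro i
  simp only [matched, Finset.mem_filter, Finset.mem_univ, true_and, ne_eq, offer_eq_none_iff]
  exact fun hi hR => hi fun x hx => h (hR x hx)

theorem card_held_le (hC : ∀ s, (C s).IsRegular) (h : IsFixed C σ R) (s : S) :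
    (atSchool (held σ (daRejections C σ)) s).card ≤ (atSchool (held σ R) s).card := by
  rw [← h.jointChoice_offers, ← (isFixed_daRejections hC σ).jointChoice_offers]
  exact card_atSchool_jointChoice_le hC (offers_mono (daRejections_subset hC h)) s

/-- The rural hospitals theorem for students. -/
theorem matched_eq (hC : ∀ s, (C s).IsRegular) (h : IsFixed C σ R) :
    matched σ R = matched σ (daRejections C σ) := by
  -- More rejections leave fewer students matched, but they also trigger more offers, from which
  -- each school holds at least as many.
  apply Finset.eq_of_subset_of_card_le (matched_anti (daRejections_subset hC h))
  rw [← card_held, ← card_held, card_eq_sum_atSchool, card_eq_sum_atSchool (held σ R)]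
  exact Finset.sum_le_sum fun s _ => card_held_le hC h s

theorem offer_eq_none_of_isFixed (hC : ∀ s, (C s).IsRegular) (h : IsFixed C σ R) (i : I) :
    offer σ R i = none ↔ deferredAcceptance C σ i = none := by
  have := congrArg (i ∈ ·) (matched_eq hC h)
  simp only [matched, Finset.mem_filter, Finset.mem_univ, true_and, ne_eq, eq_iff_iff] at this
  exact not_iff_not.1 this

/-- The rural hospitals theorem for schools. -/
theorem card_atSchool_held_eq (hC : ∀ s, (C s).IsRegular) (h : IsFixed C σ R) (s : S) :
    (atSchool (held σ (daRejections C σ)) s).card = (atSchool (held σ R) s).card := by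
  refine (Finset.sum_eq_sum_iff_of_le fun s _ => card_held_le hC h s).1 ?_ s (Finset.mem_univ s)
  rw [← card_eq_sum_atSchool, ← card_eq_sum_atSchool, card_held, card_held, matched_eq hC h]

end Contracts

/-! ### Strategy-proofness over subschools -/

section StrategyProof

variable {I S : Type*} [Fintype I] [DecidableEq I] [Fintype S] [DecidableEq S]
  {C : S → ChoiceRule I} {σ : I → PrefList S} {R : Finset (I × Subschool S)}

/-- The list that contains only `x`. -/
def PrefList.single (x : Subschool S) : PrefList S := ⟨[x], List.nodup_singleton x⟩

theorem mem_offers_update_self {i : I} {L : PrefList S} {x : Subschool S} :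
    (i, x) ∈ offers (Function.update σ i L) R ↔ Reaches L.1 R i x := by
  rw [mem_offers, Function.update_self]

theorem mem_offers_update_of_ne {i j : I} (h : j ≠ i) {L : PrefList S} {x : Subschool S} :
    (j, x) ∈ offers (Function.update σ i L) R ↔ Reaches (σ j).1 R j x := by
  rw [mem_offers, Function.update_of_ne h]

/-- If a student gets `x`, or is unmatched after having been rejected by `x`, then the rejections of
the others together with her rejection by `x`, if any, are fixed when she lists only `x`. -/
theorem IsFixed.single (hC : ∀ s, (C s).IsRegular) (h : IsFixed C σ R) {i : I} {x : Subschool S}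
    (hx : (i, x) ∈ offers σ R) (hi : ∀ y, (i, y) ∈ held σ R → y = x) :
    IsFixed C (Function.update σ i (PrefList.single x))
      (R.filter fun p => p.1 = i → p.2 = x) := by
  refine h.restrict hC ?_ ?_ ?_
  · rintro ⟨j, y⟩ hp
    by_cases hj : j = i
    · subst hj
      rw [mem_offers_update_self, PrefList.single, reaches_singleton] at hp
      rwa [hp]
    · rw [mem_offers_update_of_ne hj] at hp
      exact mem_offers.2 (hp.mono fun y hy => (Finset.mem_filter.1 hy).1)
  · rintro ⟨j, y⟩ hp
    by_cases hj : j = i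
    · subst hj
      rw [mem_offers_update_self, PrefList.single, reaches_singleton]
      exact hi y hp
    · rw [mem_offers_update_of_ne hj]
      exact (mem_offers.1 (held_subset_offers hp)).mono fun y hy => by simp [hy, hj]
  · rintro ⟨j, y⟩
    rw [Finset.mem_filter, and_congr_right_iff]
    intro hR
    by_cases hj : j = i
    · subst hj
      simp [mem_offers_update_self, PrefList.single, reaches_singleton]
    · rw [mem_offers_update_of_ne hj]
      simp only [hj, false_implies, true_iff]
      exact (mem_offers.1 ((h _).1 hR).1).mono fun y hy => by simp [hy, hj]

theorem deferredAcceptance_mem {i : I} {x : Subschool S}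
    (h : deferredAcceptance C σ i = some x) : x ∈ (σ i).1 :=
  (offer_eq_some_iff.1 h).1.mem

/-- A student who gets `x` would be matched if she listed only `x`. -/
theorem deferredAcceptance_single_ne_none (hC : ∀ s, (C s).IsRegular) {i : I} {x : Subschool S}
    (h : deferredAcceptance C σ i = some x) :
    deferredAcceptance C (Function.update σ i (PrefList.single x)) i ≠ none := by
  have hh : (i, x) ∈ held σ (daRejections C σ) := mem_held.2 h
  have hfix := (isFixed_daRejections hC σ).single hC (held_subset_offers hh) (i := i) (x := x)
    (by
      intro y hy
      rw [mem_held] at hy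
      exact Option.some_injective _ (hy.symm.trans h))
  rw [ne_eq, ← offer_eq_none_of_isFixed hC hfix, offer_eq_none_iff]
  intro hall
  exact (mem_held_iff.1 hh).2 (Finset.mem_filter.1 (hall x (by simp [PrefList.single]))).1

/-- A student who remains unmatched would remain so if she listed only one of the items of her
list. -/
theorem deferredAcceptance_single_eq_none (hC : ∀ s, (C s).IsRegular) {i : I} {x : Subschool S}
    (hx : x ∈ (σ i).1) (h : deferredAcceptance C σ i = none) :
    deferredAcceptance C (Function.update σ i (PrefList.single x)) i = none := by
  have hR := offer_eq_none_iff.1 h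
  have hfix := isFixed_daRejections hC σ
  have hfix' := hfix.single hC (((hfix _).1 (hR x hx)).1) (i := i) (x := x)
    (by
      intro y hy
      rw [mem_held] at hy
      exact absurd (hy.symm.trans h) (by simp))
  rw [← offer_eq_none_of_isFixed hC hfix', offer_eq_none_iff]
  simpa [PrefList.single] using hR x hx

/-- Subschools listed after the assigned one do not matter. -/
theorem deferredAcceptance_append (hC : ∀ s, (C s).IsRegular) {i : I} {L L' : PrefList S}
    {bs : List (Subschool S)} (hL : L'.1 = L.1 ++ bs)
    (h : deferredAcceptance C (Function.update σ i L) i ≠ none) :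
    ∃ z ∈ L.1, deferredAcceptance C (Function.update σ i L') i = some z := by
  obtain ⟨z, hz⟩ := Option.ne_none_iff_exists'.1 h
  have hzL : z ∈ L.1 := by simpa using deferredAcceptance_mem hz
  have hfix := isFixed_daRejections hC (Function.update σ i L)
  have hzR := (offer_eq_some_iff.1 hz).2
  generalize daRejections C (Function.update σ i L) = R at hfix hzR
  -- Since `z` on `L` is not rejected, `i` never gets past `L`; both lists generate the same offers,
  -- and `R` is fixed for both.
  have hoff : offers (Function.update σ i L') R = offers (Function.update σ i L) R := by
    ext ⟨j, y⟩
    by_cases hj : j = i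
    · subst hj
      rw [mem_offers_update_self, mem_offers_update_self, hL]
      constructor
      · rintro ⟨as, cs, hl, has⟩
        rcases List.append_eq_append_iff.1 hl with ⟨ds, hd, -⟩ | ⟨ds, hd, hd'⟩
        · exact absurd (has z (by simp [hd, hzL])) hzR
        · cases ds with
          | nil => exact absurd (has z (by simpa [hd] using hzL)) hzR
          | cons d ds =>
            simp only [List.cons_append, List.cons.injEq] at hd'
            exact ⟨as, ds, by rw [hd, hd'.1], has⟩
      · rintro ⟨as, cs, hl, has⟩
        exact ⟨as, cs ++ bs, by simp [hl], has⟩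
    · rw [mem_offers_update_of_ne hj, mem_offers_update_of_ne hj]
  have hfix' : IsFixed C (Function.update σ i L') R := by
    intro p
    rw [hoff]
    exact hfix p
  -- Minimality: the algorithm run with `L'` rejects no more than `R`, so an entry of `L` stays open
  -- to `i`.
  have hz' : (i, z) ∉ daRejections C (Function.update σ i L') :=
    fun hc => hzR (daRejections_subset hC hfix' hc)
  simp only [deferredAcceptance, offer, Function.update_self, hL, List.find?_append]
  have hsome : (L.1.find? fun x =>
      decide ((i, x) ∉ daRejections C (Function.update σ i L'))).isSome := by
    rw [List.find?_isSome]
    exact ⟨z, hzL, by simpa using hz'⟩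
  obtain ⟨w, hw⟩ := Option.isSome_iff_exists.1 hsome
  exact ⟨w, List.mem_of_find?_eq_some hw, by rw [hw]; rfl⟩

/-- Deferred acceptance is strategy-proof with respect to preferences over subschools. -/
theorem exists_deferredAcceptance_of_mem (hC : ∀ s, (C s).IsRegular) {i : I} {L L' : PrefList S}
    {x : Subschool S} {as bs : List (Subschool S)} (hL : L.1 = as ++ x :: bs)
    (h : deferredAcceptance C (Function.update σ i L') i = some x) :
    ∃ z ∈ as ++ [x], deferredAcceptance C (Function.update σ i L) i = some z := by
  have hL' : L.1 = (as ++ [x]) ++ bs := by simp [hL]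
  have hnd : (as ++ [x]).Nodup := (hL' ▸ L.2).of_append_left
  have h1 := deferredAcceptance_single_ne_none hC h
  rw [Function.update_idem] at h1
  -- If the segment ending in `x` left her unmatched, so would `x` alone, contradicting `h1`.
  refine deferredAcceptance_append hC (L := ⟨as ++ [x], hnd⟩) hL' fun hnone => h1 ?_
  have := deferredAcceptance_single_eq_none hC (x := x) (by simp) hnone
  rwa [Function.update_idem] at this

theorem isWeaklyDominant_of_consistentWith (hC : ∀ s, (C s).IsRegular)
    {P : Option S → Option S → Prop} (hP : IsStrictTotalOrder (Option S) P) {i : I}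
    {L : PrefList S} (hL : L.ConsistentWith P) :
    IsWeaklyDominant (deferredAcceptance C) P i L := by
  intro σ L'
  have hnone : ∀ z, deferredAcceptance C (Function.update σ i L) i = some z →
      P (some z.1) none := by
    intro z hz
    rw [← hL.mem_iff z.1 z.2]
    simpa using deferredAcceptance_mem hz
  have hweak : WeakPref P
      (Matching.school (deferredAcceptance C (Function.update σ i L)) i) none := by
    unfold Matching.school
    cases hz : deferredAcceptance C (Function.update σ i L) i with
    | none => exact Or.inr rfl
    | some z => exact Or.inl (hnone z hz)
  cases hx : deferredAcceptance C (Function.update σ i L') i with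
  | none => simpa [Matching.school, hx] using hweak
  | some x =>
    by_cases hxL : x ∈ L.1
    · obtain ⟨as, bs, hab⟩ := List.append_of_mem hxL
      obtain ⟨z, hz, hz'⟩ := exists_deferredAcceptance_of_mem hC hab hx
      simp only [Matching.school, hx, hz', Option.map_some]
      rcases List.mem_append.1 hz with hz | hz
      · have hord := hL.order
        rw [hab, List.pairwise_append] at hord
        by_cases hzx : z.1 = x.1
        · exact Or.inr (by rw [hzx])
        · exact Or.inl (hord.2.2 z hz x (by simp) hzx)
      · rw [List.mem_singleton.1 hz]
        exact Or.inr rfl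
    -- An unlisted `x` belongs to an unacceptable school, while the consistent list never yields
    -- less than `none`.
    · have hx' : P none (some x.1) := by
        have := mt (hL.mem_iff x.1 x.2).2 hxL
        rcases trichotomous_of P none (some x.1) with h | h | h
        · exact h
        · simp at h
        · exact absurd h this
      simp only [Matching.school, hx, Option.map_some]
      rcases hweak with h | h
      · exact Or.inl (_root_.trans h hx')
      · unfold Matching.school at h
        rw [h]
        exact Or.inl hx'

end StrategyProof

/-! ### Consequences of playing weakly dominant strategies -/

section Dominance

variable {I S : Type*} [Fintype I] [DecidableEq I] [Fintype S] [DecidableEq S]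
  {C : S → ChoiceRule I} {σ : I → PrefList S}

/-- Each student lists only her assignment in `μ`. -/
def Matching.lists (μ : Matching I S) (i : I) : PrefList S :=
  ⟨(μ i).toList, by cases μ i <;> simp⟩

theorem Matching.mem_lists {μ : Matching I S} {i : I} {x : Subschool S} :
    x ∈ (μ.lists i).1 ↔ μ i = some x := by
  simp [Matching.lists]

theorem reaches_lists {μ : Matching I S} {i j : I} {x : Subschool S}
    {R : Finset (I × Subschool S)} : Reaches (μ.lists i).1 R j x ↔ μ i = some x := by
  change Reaches (μ i).toList R j x ↔ μ i = some x
  cases μ i with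
  | none => simp [Reaches]
  | some y => simpa [eq_comm] using reaches_singleton (R := R) (i := j) (x := x) (y := y)

/-- If the others list only their assignments, student `i` is still assigned to the same school. -/
theorem school_update_lists (hC : ∀ s, (C s).IsRegular) (σ : I → PrefList S) (i : I) :
    Matching.school (deferredAcceptance C
      (Function.update (deferredAcceptance C σ).lists i (σ i))) i =
    Matching.school (deferredAcceptance C σ) i := by
  set τ := Function.update (deferredAcceptance C σ).lists i (σ i) with hτ
  set R := daRejections C σ with hR
  -- The others now offer only contracts that are held under `R`, so only the rejections of `i`
  -- survive.
  set R' := R.filter fun p => p.1 = i with hR'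
  have hfix : IsFixed C σ R := isFixed_daRejections hC σ
  have hself : ∀ y, (i, y) ∈ offers τ R' ↔ (i, y) ∈ offers σ R := by
    intro y
    rw [hτ, mem_offers_update_self, mem_offers]
    exact ⟨fun h => h.mono fun y hy => (Finset.mem_filter.1 hy).1,
      fun h => h.mono fun y hy => Finset.mem_filter.2 ⟨hy, rfl⟩⟩
  have hne : ∀ j, j ≠ i → ∀ y, (j, y) ∈ offers τ R' ↔ (j, y) ∈ held σ R := by
    intro j hj y
    rw [hτ, mem_offers_update_of_ne hj, reaches_lists, mem_held]
    rfl
  have hfix' : IsFixed C τ R' := by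
    refine hfix.restrict hC ?_ ?_ ?_
    · rintro ⟨j, y⟩ hp
      by_cases hj : j = i
      · subst hj; exact (hself y).1 hp
      · exact held_subset_offers ((hne j hj y).1 hp)
    · rintro ⟨j, y⟩ hp
      by_cases hj : j = i
      · subst hj; exact (hself y).2 (held_subset_offers hp)
      · exact (hne j hj y).2 hp
    · rintro ⟨j, y⟩
      rw [hR', Finset.mem_filter, and_congr_right_iff, ← hR']
      intro hp
      by_cases hj : j = i
      · subst hj
        simpa [hself] using ((hfix _).1 hp).1
      · simp only [hj, hne j hj, mem_held_iff, false_iff, not_and, not_not]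
        exact fun _ => hp
  have hheld : held τ R' = held σ R := by
    ext ⟨j, y⟩
    by_cases hj : j = i
    · subst hj
      have hRR : (j, y) ∈ R' ↔ (j, y) ∈ R := by simp [hR']
      rw [mem_held_iff, mem_held_iff, hself, hRR]
    · rw [mem_held_iff, hne j hj]
      simp [hR', hj]
  have hoffer : ∀ j, offer τ R' j = deferredAcceptance C σ j := by
    intro j
    apply Option.ext
    intro y
    rw [← mem_held, hheld, mem_held]
    rfl
  have hnone := fun j => (hoffer j ▸ offer_eq_none_of_isFixed hC hfix' j :
    deferredAcceptance C σ j = none ↔ deferredAcceptance C τ j = none)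
  have hcard := fun s => hheld ▸ card_atSchool_held_eq hC hfix' s
  unfold Matching.school
  cases hz : deferredAcceptance C τ i with
  | none => rw [(hnone i).2 hz]
  | some z =>
    cases hy : deferredAcceptance C σ i with
    | none => rw [(hnone i).1 hy] at hz; simp at hz
    | some y =>
      by_contra hzy
      -- All matched students other than `i` remain matched and have a single entry, so they keep
      -- their seats. A new school for `i` would then hold one student more than the rural hospitals
      -- theorem allows. Counts per school determine only her school, not her seat type.
      refine (hcard z.1).not_gt (Finset.card_lt_card ?_)
      rw [Finset.ssubset_iff_of_subset]
      · refine ⟨(i, z), ?_, ?_⟩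
        · exact Finset.mem_filter.2 ⟨mem_held.2 hz, rfl⟩
        · intro hmem
          have : deferredAcceptance C σ i = some z := mem_held.1 (Finset.mem_filter.1 hmem).1
          rw [hy] at this
          exact hzy (by rw [this])
      · rintro ⟨j, w⟩ hp
        obtain ⟨hp, hw⟩ := Finset.mem_filter.1 hp
        have hw' : deferredAcceptance C σ j = some w := mem_held.1 hp
        have hj : j ≠ i := by
          rintro rfl
          rw [hy] at hw'
          exact hzy (by rw [hw']; simpa using hw.symm)
        refine Finset.mem_filter.2 ⟨mem_held.2 ?_, hw⟩
        change deferredAcceptance C τ j = some w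
        have hsome : deferredAcceptance C τ j ≠ none := by
          rw [ne_eq, ← hnone, hw']
          simp
        obtain ⟨v, hv⟩ := Option.ne_none_iff_exists'.1 hsome
        have hmem := deferredAcceptance_mem hv
        rw [hτ, Function.update_of_ne hj, Matching.mem_lists, hw'] at hmem
        rw [hv, hmem]

/-- If `i` would be selected by `x` among those assigned in `μ`, she gets `x` by listing only `x`
when the others list only their assignments. -/
theorem deferredAcceptance_lists_single (hC : ∀ s, (C s).IsRegular) {μ : Matching I S} {i : I}
    {x : Subschool S} {Y : Finset (I × Subschool S)} (hself : ∀ y, (i, y) ∈ Y ↔ y = x)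
    (hne : ∀ j, j ≠ i → ∀ y, (j, y) ∈ Y ↔ μ j = some y) (h : (i, x) ∈ jointChoice C Y) :
    deferredAcceptance C (Function.update μ.lists i (PrefList.single x)) i = some x := by
  set τ := Function.update μ.lists i (PrefList.single x) with hτ
  -- No list has more than one entry, so the pool of offers does not depend on the rejections.
  have hoff : ∀ R, offers τ R = Y := by
    intro R
    ext ⟨j, y⟩
    by_cases hj : j = i
    · subst hj
      rw [hτ, mem_offers_update_self, PrefList.single, reaches_singleton, hself]
    · rw [hτ, mem_offers_update_of_ne hj, reaches_lists, hne j hj]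
  have hfix := isFixed_daRejections hC τ
  rw [← hoff (daRejections C τ), hfix.jointChoice_offers, mem_held] at h
  exact h

/-- A student who plays a weakly dominant strategy would not be selected by a school that she
prefers to her assignment. -/
theorem not_mem_jointChoice_of_isWeaklyDominant (hC : ∀ s, (C s).IsRegular)
    {P : Option S → Option S → Prop} (hP : IsStrictTotalOrder (Option S) P) {i : I}
    (hi : IsWeaklyDominant (deferredAcceptance C) P i (σ i)) {x : Subschool S}
    (hx : P (some x.1) (Matching.school (deferredAcceptance C σ) i))
    {Y : Finset (I × Subschool S)} (hself : ∀ y, (i, y) ∈ Y ↔ y = x)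
    (hne : ∀ j, j ≠ i → ∀ y, (j, y) ∈ Y ↔ deferredAcceptance C σ j = some y) :
    (i, x) ∉ jointChoice C Y := by
  intro h
  have h1 := deferredAcceptance_lists_single hC hself hne h
  have h2 := hi (deferredAcceptance C σ).lists (PrefList.single x)
  rw [school_update_lists hC] at h2
  have h3 : Matching.school (deferredAcceptance C (Function.update (deferredAcceptance C σ).lists i
      (PrefList.single x))) i = some x.1 := by rw [Matching.school, h1]; rfl
  rw [h3] at h2
  rcases h2 with h2 | h2
  · exact irrefl_of P _ (_root_.trans hx h2)
  · rw [h2] at hx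
    exact irrefl_of P _ hx

/-- The students who are assigned to the subschool `x`. -/
def Matching.holders (μ : Matching I S) (x : Subschool S) : Finset I :=
  Finset.univ.filter fun i => μ i = some x

theorem Matching.mem_holders {μ : Matching I S} {x : Subschool S} {i : I} :
    i ∈ μ.holders x ↔ μ i = some x := by
  simp [Matching.holders]

theorem choice_holders (hC : ∀ s, (C s).IsRegular) (σ : I → PrefList S) (s : S) (t : Seat) :
    C s (Matching.holders (deferredAcceptance C σ) (s, Seat.opn))
      (Matching.holders (deferredAcceptance C σ) (s, Seat.res)) t =
    Matching.holders (deferredAcceptance C σ) (s, t) := by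
  have hfix := isFixed_daRejections hC σ
  have h : jointChoice C (held σ (daRejections C σ)) = held σ (daRejections C σ) := by
    rw [← hfix.jointChoice_offers]
    -- Choosing again from the chosen contracts rejects nothing.
    refine jointChoice_eq_of_subset hC jointChoice_subset subset_rfl
  have := congrArg (fun Y => proposers Y (s, t)) h
  simp only [proposers_jointChoice hC, proposers_held] at this
  exact this

/-- A student who plays a weakly dominant strategy would not be selected for either type of seat if
she joined the students assigned to a school that she prefers. -/
theorem not_mem_choice_of_isWeaklyDominant (hC : ∀ s, (C s).IsRegular)
    {P : Option S → Option S → Prop} (hP : IsStrictTotalOrder (Option S) P) {i : I}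
    (hi : IsWeaklyDominant (deferredAcceptance C) P i (σ i)) {s : S}
    (hs : P (some s) (Matching.school (deferredAcceptance C σ) i)) (t : Seat)
    {A A' : Finset I}
    (hA : ∀ j, j ∈ A ↔
      j ∈ Matching.holders (deferredAcceptance C σ) (s, Seat.opn) ∨ (j = i ∧ t = Seat.opn))
    (hA' : ∀ j, j ∈ A' ↔
      j ∈ Matching.holders (deferredAcceptance C σ) (s, Seat.res) ∨ (j = i ∧ t = Seat.res)) :
    i ∉ C s A A' t := by
  -- The present assignment, with the contract of `i`, if any, replaced by `(s, t)`.
  set Y : Finset (I × Subschool S) := Finset.univ.filter fun p =>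
    if p.1 = i then p.2 = (s, t) else deferredAcceptance C σ p.1 = some p.2 with hY
  have hself : ∀ y, (i, y) ∈ Y ↔ y = (s, t) := by simp [hY]
  have hne : ∀ j, j ≠ i → ∀ y, (j, y) ∈ Y ↔ deferredAcceptance C σ j = some y := by
    intro j hj y
    simp [hY, hj]
  have key := not_mem_jointChoice_of_isWeaklyDominant hC hP hi (x := (s, t)) hs hself hne
  have hnot : ∀ t', deferredAcceptance C σ i ≠ some (s, t') := by
    intro t' h
    rw [Matching.school, h] at hs
    exact irrefl_of P _ hs
  have h1 : proposers Y (s, Seat.opn) = A := by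
    ext j
    rw [mem_proposers, hA, Matching.mem_holders]
    by_cases hj : j = i
    · subst hj
      simp [hself, hnot, eq_comm]
    · simp [hne j hj, hj]
  have h2 : proposers Y (s, Seat.res) = A' := by
    ext j
    rw [mem_proposers, hA', Matching.mem_holders]
    by_cases hj : j = i
    · subst hj
      simp [hself, hnot, eq_comm]
    · simp [hne j hj, hj]
  rwa [mem_jointChoice hC, h1, h2] at key

end Dominance

/-! ### The choice rules of SimSep and SimFlex -/

namespace Problem

variable {I S M : Type*} [Fintype I] [DecidableEq I] [Fintype S] [DecidableEq S]
  [Fintype M] [DecidableEq M] (E : Problem I S M) {s : S} {A A' B B' : Finset I} {i j : I} {n k : ℕ}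

theorem top_subset : E.top s n A ⊆ A := Finset.filter_subset _ _

theorem mem_top : i ∈ E.top s n A ↔ i ∈ A ∧ (A.filter fun j => E.π i s < E.π j s).card < n := by
  simp [top]

variable {E} in
theorem mem_top_of_subset (h : A ⊆ B) (hn : k ≤ n) (hi : i ∈ A) (hB : i ∈ E.top s k B) :
    i ∈ E.top s n A := by
  rw [mem_top] at *
  exact ⟨hi, (Finset.card_le_card (Finset.filter_subset_filter _ h)).trans_lt
    (hB.2.trans_le hn)⟩

variable {E} in
theorem mem_top_of_lt (hi : i ∈ A) (hj : j ∈ E.top s n A) (h : E.π j s < E.π i s) :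
    i ∈ E.top s n A := by
  rw [mem_top] at *
  refine ⟨hi, (Finset.card_le_card ?_).trans_lt hj.2⟩
  intro a ha
  rw [Finset.mem_filter] at *
  exact ⟨ha.1, h.trans ha.2⟩

/-- With strict priorities, the number of higher-ranked competitors is a bijection from `A` onto the
integers below `A.card`; `top` keeps the values below `n`. -/
theorem card_top (s : S) (n : ℕ) (A : Finset I) : (E.top s n A).card = min n A.card := by
  set r : I → ℕ := fun i => (A.filter fun j => E.π i s < E.π j s).card with hr
  have hlt : ∀ i ∈ A, ∀ j ∈ A, E.π i s < E.π j s → r j < r i := by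
    intro i _ j hj h
    apply Finset.card_lt_card
    rw [Finset.ssubset_iff_of_subset]
    · exact ⟨j, by simp [hj, h], by simp⟩
    · intro a ha
      rw [Finset.mem_filter] at *
      exact ⟨ha.1, h.trans ha.2⟩
  have hinj : Set.InjOn r A := by
    intro i hi j hj hij
    by_contra hne
    rcases lt_or_gt_of_ne fun h => hne (E.π_inj s h) with h | h
    · exact (hlt i hi j hj h).ne' hij
    · exact (hlt j hj i hi h).ne hij
  have himg : A.image r = Finset.range A.card := by
    apply Finset.eq_of_subset_of_card_le
    · intro k hk
      obtain ⟨i, hi, rfl⟩ := Finset.mem_image.1 hk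
      refine Finset.mem_range.2 (Finset.card_lt_card ?_)
      exact (Finset.ssubset_iff_of_subset (Finset.filter_subset _ _)).2 ⟨i, hi, by simp⟩
    · rw [Finset.card_image_of_injOn hinj, Finset.card_range]
  have htop : (E.top s n A).image r = Finset.range (min n A.card) := by
    ext k
    simp only [Finset.mem_image, mem_top, Finset.mem_range, lt_min_iff, ← Finset.mem_range
      (n := A.card), ← himg]
    grind
  rw [← Finset.card_image_of_injOn (hinj.mono (Finset.coe_subset.2 E.top_subset)), htop,
    Finset.card_range]

variable {E} in
/-- If a newcomer is not selected, the quota is filled by students of higher priority. -/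
theorem top_eq_of_insert (hi : i ∉ E.top s n (insert i A)) (hA : A.card ≤ n) :
    A.card = n ∧ ∀ j ∈ A, ¬ E.π j s < E.π i s := by
  have hsub : E.top s n (insert i A) ⊆ A := by
    intro j hj
    rcases Finset.mem_insert.1 (E.top_subset hj) with rfl | h
    · exact absurd hj hi
    · exact h
  have hcard := E.card_top s n (insert i A)
  have hle := Finset.card_le_card hsub
  have hA' : A.card ≤ (insert i A).card := Finset.card_le_card (Finset.subset_insert _ _)
  have hiA : n ≤ (insert i A).card := by
    by_contra hlt
    have : E.top s n (insert i A) = insert i A :=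
      Finset.eq_of_subset_of_card_le E.top_subset (by omega)
    exact hi (by rw [this]; exact Finset.mem_insert_self i A)
  have heq : A.card = n := by omega
  refine ⟨heq, fun j hj hlt => hi ?_⟩
  have htop : E.top s n (insert i A) = A := Finset.eq_of_subset_of_card_le hsub (by omega)
  have hj' : j ∈ E.top s n (insert i A) := by rwa [htop]
  exact mem_top_of_lt (Finset.mem_insert_self i A) hj' hlt

theorem mem_chooseReserved :
    i ∈ E.chooseReserved s A ↔ i ∈ E.top s (E.qr s (E.τ i)) (A.filter fun j => E.τ j = E.τ i) := by
  simp only [chooseReserved, Finset.mem_biUnion, Finset.mem_univ, true_and]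
  constructor
  · rintro ⟨m, hm⟩
    obtain rfl : E.τ i = m := (Finset.mem_filter.1 (E.top_subset hm)).2
    exact hm
  · exact fun h => ⟨_, h⟩

theorem chooseReserved_subset : E.chooseReserved s A ⊆ A := by
  intro i hi
  exact (Finset.mem_filter.1 (E.top_subset (E.mem_chooseReserved.1 hi))).1

theorem filter_chooseReserved (s : S) (A : Finset I) (m : M) :
    (E.chooseReserved s A).filter (fun i => E.τ i = m) =
      E.top s (E.qr s m) (A.filter fun i => E.τ i = m) := by
  ext i
  rw [Finset.mem_filter, mem_chooseReserved]
  constructor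
  · rintro ⟨h, rfl⟩
    exact h
  · intro h
    obtain rfl : E.τ i = m := (Finset.mem_filter.1 (E.top_subset h)).2
    exact ⟨h, rfl⟩

theorem card_chooseReserved (s : S) (A : Finset I) :
    (E.chooseReserved s A).card =
      ∑ m, min (E.qr s m) (A.filter fun i => E.τ i = m).card := by
  rw [Finset.card_eq_sum_card_fiberwise (f := E.τ) (t := Finset.univ) (by simp)]
  exact Finset.sum_congr rfl fun m _ => by rw [filter_chooseReserved, card_top]

variable {E} in
theorem mem_chooseReserved_of_subset (h : A ⊆ B) (hi : i ∈ A) (hB : i ∈ E.chooseReserved s B) :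
    i ∈ E.chooseReserved s A := by
  rw [mem_chooseReserved] at *
  exact mem_top_of_subset (Finset.filter_subset_filter _ h) le_rfl (by simp [hi]) hB

variable {E} in
theorem card_chooseReserved_mono (h : A ⊆ B) :
    (E.chooseReserved s A).card ≤ (E.chooseReserved s B).card := by
  rw [card_chooseReserved, card_chooseReserved]
  exact Finset.sum_le_sum fun m _ =>
    min_le_min_left _ (Finset.card_le_card (Finset.filter_subset_filter _ h))

theorem card_chooseReserved_le (s : S) (A : Finset I) : (E.chooseReserved s A).card ≤ E.q s := by
  rw [card_chooseReserved]
  exact (Finset.sum_le_sum fun m _ => min_le_left _ _).trans (E.sum_qr_lt s).le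

theorem isRegular_choiceSep (s : S) : (E.choiceSep s).IsRegular where
  subset_opn _ _ := E.top_subset
  subset_res _ _ := E.chooseReserved_subset
  subst_opn h _ hi hB := mem_top_of_subset h le_rfl hi hB
  subst_res _ h' hi hB := mem_chooseReserved_of_subset h' hi hB
  card_le h h' := by
    refine add_le_add ?_ (card_chooseReserved_mono h')
    simp only [choiceSep, card_top]
    exact min_le_min_left _ (Finset.card_le_card h)

/-- More reserved applicants take at least as many reserved seats, so the open quota can only
shrink, which gives substitutability. A school selects `min (q s) (a + r)` students in total, with
`a` open applicants and `r ≤ q s` reserved seats taken; this is monotone although the open part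
alone is not. -/
theorem isRegular_choiceFlex (s : S) : (E.choiceFlex s).IsRegular where
  subset_opn _ _ := E.top_subset
  subset_res _ _ := E.chooseReserved_subset
  subst_opn h h' hi hB :=
    mem_top_of_subset h (Nat.sub_le_sub_left (card_chooseReserved_mono h') _) hi hB
  subst_res _ h' hi hB := mem_chooseReserved_of_subset h' hi hB
  card_le {A A' B B'} h h' := by
    simp only [choiceFlex, card_top]
    have h1 := Finset.card_le_card h
    have h2 : (E.chooseReserved s A').card ≤ _ := card_chooseReserved_mono h'
    have h3 := E.card_chooseReserved_le s B'
    omega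

/-! ### Stability of SimFlex -/

theorem isStable_simFlex (P : I → Option S → Option S → Prop)
    (hP : ∀ i, IsStrictTotalOrder (Option S) (P i)) (σ : I → PrefList S)
    (hσ : ∀ i, IsWeaklyDominant E.simFlex (P i) i (σ i)) : E.IsStable P (E.simFlex σ) := by
  set μ := E.simFlex σ with hμ
  set Ho := fun s => μ.holders (s, Seat.opn) with hHo
  set Hr := fun s => μ.holders (s, Seat.res) with hHr
  have hopn : ∀ s, E.top s (E.q s - (Hr s).card) (Ho s) = Ho s := by
    intro s
    have h := choice_holders E.isRegular_choiceFlex σ s Seat.opn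
    have h' := choice_holders E.isRegular_choiceFlex σ s Seat.res
    simp only [choiceFlex] at h h'
    rwa [h'] at h
  have hres : ∀ s, E.chooseReserved s (Hr s) = Hr s := fun s =>
    choice_holders E.isRegular_choiceFlex σ s Seat.res
  have hadm : ∀ s, (μ.admitted s).card = (Ho s).card + (Hr s).card := by
    intro s
    rw [← Finset.card_union_of_disjoint]
    · congr 1
      ext i
      rw [Matching.admitted, Finset.mem_filter, Matching.school, Finset.mem_union,
        Matching.mem_holders, Matching.mem_holders]
      cases μ i with
      | none => simp
      | some x => obtain ⟨s', t⟩ := x; cases t <;> simp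
    · rw [Finset.disjoint_left]
      intro i hi hi'
      simp only [hHo, hHr, Matching.mem_holders] at hi hi'
      rw [hi] at hi'
      simp at hi'
  have hreserved : ∀ s m, μ.reservedOf E.τ s m = (Hr s).filter fun i => E.τ i = m := by
    intro s m
    ext i
    simp [Matching.reservedOf, hHr, Matching.mem_holders]
  have hoCard : ∀ s, (Ho s).card ≤ E.q s - (Hr s).card := by
    intro s
    conv_lhs => rw [← hopn s, card_top]
    exact min_le_left _ _
  have hrCard : ∀ s, (Hr s).card ≤ E.q s := fun s => hres s ▸ E.card_chooseReserved_le s _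
  have hrmCard : ∀ s m, ((Hr s).filter fun i => E.τ i = m).card ≤ E.qr s m := by
    intro s m
    conv_lhs => rw [← hres s, filter_chooseReserved, card_top]
    exact min_le_left _ _
  have keyO : ∀ i s, P i (some s) (μ.school i) →
      (Ho s).card = E.q s - (Hr s).card ∧ ∀ j ∈ Ho s, ¬ E.π j s < E.π i s := by
    intro i s hs
    have h := not_mem_choice_of_isWeaklyDominant E.isRegular_choiceFlex (hP i) (hσ i) hs Seat.opn
      (A := insert i (Ho s)) (A' := Hr s)
      (by intro j; simp [hHo, hμ, simFlex, or_comm]) (by intro j; simp [hHr, hμ, simFlex])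
    -- Joining the open applicants leaves the reserved selection at `Hr s`, so the open quota is
    -- still `E.q s - (Hr s).card`.
    simp only [choiceFlex, hres] at h
    exact top_eq_of_insert h (hoCard s)
  have keyR : ∀ i s, P i (some s) (μ.school i) →
      ((Hr s).filter fun j => E.τ j = E.τ i).card = E.qr s (E.τ i) ∧
        ∀ j ∈ (Hr s).filter fun j => E.τ j = E.τ i, ¬ E.π j s < E.π i s := by
    intro i s hs
    have h := not_mem_choice_of_isWeaklyDominant E.isRegular_choiceFlex (hP i) (hσ i) hs Seat.res
      (A := Ho s) (A' := insert i (Hr s))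
      (by intro j; simp [hHo, hμ, simFlex]) (by intro j; simp [hHr, hμ, simFlex, or_comm])
    simp only [choiceFlex, mem_chooseReserved, Finset.filter_insert, if_true] at h
    exact top_eq_of_insert h (hrmCard s _)
  refine ⟨⟨?_, ?_⟩, ?_, ?_, ?_, ?_⟩
  · intro s
    have := hoCard s
    have := hrCard s
    rw [hadm]
    omega
  · intro s m
    rw [hreserved]
    exact hrmCard s m
  · intro i
    -- Individual rationality comes from comparison with the empty list, which leaves `i` unmatched.
    have h := hσ i σ ⟨[], List.nodup_nil⟩
    rw [Function.update_eq_self] at h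
    have h' : Matching.school (E.simFlex (Function.update σ i ⟨[], List.nodup_nil⟩)) i = none := by
      simp [Matching.school, simFlex, deferredAcceptance, offer]
    rwa [h'] at h
  · intro i s hs
    have := (keyO i s hs).1
    -- This makes the truncated subtraction in the open quota exact.
    have := hrCard s
    rw [hadm]
    omega
  · intro i s hs
    rw [hreserved]
    exact (keyR i s hs).1
  · rintro i j ⟨s, hj, hs, hlt, hor⟩
    obtain ⟨⟨s', t⟩, hjt, hs'⟩ := Option.map_eq_some_iff.1 hj
    obtain rfl : s' = s := hs'
    cases t with
    | opn => exact (keyO i s' hs).2 j (Matching.mem_holders.2 hjt) hlt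
    | res =>
      rcases hor with hτ | hor
      · exact (keyR i s' hs).2 j
          (Finset.mem_filter.2 ⟨Matching.mem_holders.2 hjt, hτ.symm⟩) hlt
      · rw [hjt] at hor
        simp at hor

end Problem

end SchoolChoice

theorem mainTheorem6 {I S M : Type*} [Fintype I] [DecidableEq I] [Fintype S] [DecidableEq S]
    [Fintype M] [DecidableEq M] (E : SchoolChoice.Problem I S M)
    (P : I → Option S → Option S → Prop) (hP : ∀ i, IsStrictTotalOrder (Option S) (P i)) :
    -- submitting a consistent list is weakly dominant in SimSep and in SimFlex
    (∀ (i : I) (L : SchoolChoice.PrefList S), L.ConsistentWith (P i) →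
      SchoolChoice.IsWeaklyDominant E.simSep (P i) i L ∧
      SchoolChoice.IsWeaklyDominant E.simFlex (P i) i L) ∧
    -- if all students submit consistent lists, SimFlex yields a stable matching
    (∀ σ : I → SchoolChoice.PrefList S, (∀ i, (σ i).ConsistentWith (P i)) →
      E.IsStable P (E.simFlex σ)) ∧
    -- more generally, this holds if all students play weakly dominant strategies
    (∀ σ : I → SchoolChoice.PrefList S,
      (∀ i, SchoolChoice.IsWeaklyDominant E.simFlex (P i) i (σ i)) →
      E.IsStable P (E.simFlex σ)) := by
  have h1 : ∀ (i : I) (L : SchoolChoice.PrefList S), L.ConsistentWith (P i) →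
      SchoolChoice.IsWeaklyDominant E.simSep (P i) i L ∧
      SchoolChoice.IsWeaklyDominant E.simFlex (P i) i L := fun i _ hL =>
    ⟨SchoolChoice.isWeaklyDominant_of_consistentWith E.isRegular_choiceSep (hP i) hL,
      SchoolChoice.isWeaklyDominant_of_consistentWith E.isRegular_choiceFlex (hP i) hL⟩
  exact ⟨h1, fun σ hσ => E.isStable_simFlex P hP σ fun i => (h1 i _ (hσ i)).2,
    fun σ hσ => E.isStable_simFlex P hP σ hσ⟩
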